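/- All graphs are finite, simple and undirected, and $\rho(G)$ denotes the spectral radius of the adjacency matrix of $G$. For a bipartite graph $G$ with bipartition $(X,Y)$, its quasi-complement $\widehat{G}$ is the bipartite graph on the same vertex set in which $x\in X$ and $y\in Y$ are adjacent if and only if they are not adjacent in $G$. For bipartite graphs $G_1,G_2$ with bipartitions $(X_1,Y_1)$ and $(X_2,Y_2)$, let $G_1\sqcup G_2$ be the graph obtained from the disjoint union of $G_1$ and $G_2$ by adding all edges between $X_1$ and $Y_2$ and all edges between $Y_1$ and $X_2$. A $k$-factor on a vertex set $V$ is a $k$-regular graph $F$ with vertex set $V$. A family $(G_i)_{i\in I}$ of graphs on $V$ has a rainbow $k$-factor if there are a $k$-factor $F$ on $V$ and a bijection $\phi:E(F)\to I$ such that $e\in E(G_{\phi(e)})$ for every $e\in E(F)$. **Theorem 1.2.** Let $k\ge 2$ and $n\ge 2k$ be integers, let $(X,Y)$ be a partition of $[2n]$ with $|X|=|Y|=n$, and put $B_{n,k}=K_{k-1,n-1}\sqcup\widehat{K_{n-k+1,1}}$, where $K_{a,b}$ has the bipartition whose first part has $a$ and whose second part has $b$ vertices. (1) Let $G_1,\dots,G_{kn}$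 be not necessarily distinct bipartite graphs on the vertex set $[2n]$, all with bipartition $(X,Y)$, such that $\rho(G_i)\ge\rho(B_{n,k})$ for every $i\in[kn]$. Then the family $(G_1,\dots,G_{kn})$ has a rainbow $k$-factor, unless $G_1=G_2=\dots=G_{kn}\cong B_{n,k}$; and in this exceptional case it has no rainbow $k$-factor. (2) The bound is tight: there is a bipartite graph $H$ on $[2n]$ with bipartition $(X,Y)$ and $H\cong B_{n,k}$, hence $\rho(H)=\rho(B_{n,k})$, such that the family consisting of $kn$ copies of $H$ has no rainbow $k$-factor. -/

import Mathlib

/-- The quasi-complement of a bipartite graph `G` with the bipartition `(α, β)`: the bipartite graph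
with the same bipartition in which `x ∈ α` and `y ∈ β` are adjacent iff they are not adjacent
in `G`. -/
def quasiComplement {α β : Type*} (G : SimpleGraph (α ⊕ β)) : SimpleGraph (α ⊕ β) :=
  completeBipartiteGraph α β \ G

/-- For bipartite graphs `G₁` with bipartition `(α₁, β₁)` and `G₂` with bipartition `(α₂, β₂)`,
the disjoint union of `G₁` and `G₂` together with all edges between `α₁` and `β₂` and all edges
between `β₁` and `α₂`. -/
def bipartiteJoin {α₁ β₁ α₂ β₂ : Type*} (G₁ : SimpleGraph (α₁ ⊕ β₁))
    (G₂ : SimpleGraph (α₂ ⊕ β₂)) : SimpleGraph ((α₁ ⊕ β₁) ⊕ (α₂ ⊕ β₂)) :=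
  SimpleGraph.sum G₁ G₂ ⊔ SimpleGraph.fromRel (fun u v =>
    (∃ (x : α₁) (y : β₂), u = Sum.inl (Sum.inl x) ∧ v = Sum.inr (Sum.inr y)) ∨
    (∃ (y : β₁) (x : α₂), u = Sum.inl (Sum.inr y) ∧ v = Sum.inr (Sum.inl x)))

/-- The graph `K_{k-1,n-1} ⊔ \widehat{K_{n-k+1,1}}`. -/
def extremalGraph (n k : ℕ) :
    SimpleGraph ((Fin (k - 1) ⊕ Fin (n - 1)) ⊕ (Fin (n - k + 1) ⊕ Fin 1)) :=
  bipartiteJoin (completeBipartiteGraph (Fin (k - 1)) (Fin (n - 1)))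
    (quasiComplement (completeBipartiteGraph (Fin (n - k + 1)) (Fin 1)))

open Classical in
/-- The spectral radius of a finite graph: the spectral radius of its adjacency matrix, i.e. the
largest absolute value of an eigenvalue (the matrix is real symmetric, so all its eigenvalues are
real). -/
noncomputable def graphSpectralRadius {V : Type*} [Fintype V] (G : SimpleGraph V) : ENNReal :=
  spectralRadius ℝ (G.adjMatrix ℝ)

open Classical in
/-- The family `G` of graphs on the vertex set `V` has a rainbow `k`-factor: there is a `k`-regular
graph `F` on all of `V`, with a bijection `φ` from the edges of `F` to the index set of
the family such that each edge `e` belongs to `G (φ e)`. -/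
def HasRainbowFactor {V ι : Type*} [Fintype V] (G : ι → SimpleGraph V) (k : ℕ) : Prop :=
  ∃ F : SimpleGraph V, F.IsRegularOfDegree k ∧
    ∃ φ : F.edgeSet ≃ ι, ∀ e : F.edgeSet, (e : Sym2 V) ∈ (G (φ e)).edgeSet

/-!
Call a pair of vertices `(x, y)` *missing* in a colour `i` if it is not an edge of `G i`. In
`B = extremalGraph n k` the missing pairs are `n - k + 1` pairs at one vertex, so that this vertex
has only `k - 1` neighbours and no `k`-factor exists.

The spectral hypothesis is used through three consequences. A bipartite graph satisfies
`ρ ^ 2 ≤ e` (`realSpectralRadius_sq_le`), while `ρ(B) ^ 2 > n * (n - 1)`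
(`lt_realSpectralRadius_starDeletedGraph_sq`); hence every colour misses at most `n - 1` pairs. The
spectral radius increases strictly when edges are added to reach a connected graph
(`eq_of_le_of_realSpectralRadius_le`); hence all degrees are at least `k - 1`, and a vertex of
degree `k - 1` forces `G i` to be the copy of `B` determined by the neighbours of that vertex. So,
outside the exceptional case, no vertex has the same `k - 1` neighbours in all colours.

The rest is combinatorial (`exists_rainbow_factor`). By Hall's theorem, a `k`-factor `F` can be
coloured bijectively unless some `T ⊆ F` is missing in more than `k * n - #T` colours
(`exists_rainbow_equiv`). As colours miss at most `n - 1` pairs, such a `T` consists of *popular*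
pairs, missing in at least `(k - 1) * n + 2` colours, and double counting leaves at most `2 * (n - k)`
popular pairs. If every vertex is in at most `n - k` of them, some `k`-factor avoids them all
(`exists_rainbow_factor_of_card_le`). Otherwise some vertex `y` is in at least `n - k + 1` popular
pairs. Hall's theorem gives `k` distinct neighbours of `y` in `k` distinct colours, as any fewer
than `k` colours see at least `k - 1` neighbours and two colours can be included that together see
`k`. The at most `n - k - 1` other popular pairs are too few to prevent a `k`-factor that has exactly
these edges at `y`, and its popular pairs satisfy Hall's condition by the choice of the edges at `y`
(`exists_rainbow_factor_of_lt_card`). The `k`-factors come from the Ore–Ryser criterion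
`exists_bipartite_factor`.
-/

/-! ### Numerical inequalities -/

/-- The bilinear function `u * v + j * (N - u - v)` is nonnegative on `[0, N] × [0, N]`, since it is so
at the corners. -/
theorem mul_add_le_mul_add_mul {u v N j : ℕ} (hu : u ≤ N) (hv : v ≤ N) (hj : j ≤ N) :
    j * (u + v) ≤ u * v + j * N := by
  rcases le_total (u + v) N with h | h
  · exact le_add_left (Nat.mul_le_mul_left j h)
  · obtain ⟨a, rfl⟩ := Nat.exists_eq_add_of_le hu
    obtain ⟨w, rfl⟩ := Nat.exists_eq_add_of_le (show a ≤ v by omega)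
    obtain ⟨b, rfl⟩ := Nat.exists_eq_add_of_le (show w ≤ u by omega)
    nlinarith

/-- The hypothesis of `exists_bipartite_factor` for the complement of `p` pairs. Here `a` and `b` are
the sizes of the two vertex sets, `r` counts the present and `p` the removed pairs between them; sets
of size one are the ones that need a bound of their own on `p`. -/
theorem factor_ineq {n k a b r p : ℕ} (hk : 2 ≤ k) (hn : 2 * k ≤ n) (ha : a ≤ n) (hb : b ≤ n)
    (hr : a * b ≤ r + p) (hp : p ≤ 2 * (n - k)) (ha1 : a = 1 → p ≤ n - k)
    (hb1 : b = 1 → p ≤ n - k) : k * (a + b) ≤ r + k * n := by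
  obtain ⟨j, rfl⟩ := Nat.exists_eq_add_of_le hk
  obtain ⟨N, rfl⟩ := Nat.exists_eq_add_of_le (show 2 + j ≤ n by omega)
  rw [show 2 + j + N - (2 + j) = N by omega] at *
  obtain rfl | rfl | ha2 : a = 0 ∨ a = 1 ∨ 2 ≤ a := by omega
  · nlinarith
  · have := ha1 rfl
    nlinarith
  obtain rfl | rfl | hb2 : b = 0 ∨ b = 1 ∨ 2 ≤ b := by omega
  · nlinarith
  · have := hb1 rfl
    nlinarith
  obtain ⟨u, rfl⟩ := Nat.exists_eq_add_of_le ha2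
  obtain ⟨v, rfl⟩ := Nat.exists_eq_add_of_le hb2
  have := mul_add_le_mul_add_mul (u := u) (v := v) (N := j + N) (j := j) (by omega)
    (by omega) (by omega)
  nlinarith

/-- The hypothesis of `exists_bipartite_factor` when the second set, of size `b`, misses a vertex `y`
and at most `n - k - 1` pairs are removed off `y`. -/
theorem factor_ineq_of_notMem {n k a b r p : ℕ} (hk : 1 ≤ k) (hn : k ≤ n) (ha : a ≤ n)
    (hb : b + 1 ≤ n) (hr : a * b ≤ r + p) (hp : p + k + 1 ≤ n) :
    k * (a + b) ≤ r + k * n := by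
  obtain ⟨j, rfl⟩ := Nat.exists_eq_add_of_le hk
  obtain ⟨N, rfl⟩ := Nat.exists_eq_add_of_le (hk.trans hn)
  obtain rfl | ha1 : a = 0 ∨ 1 ≤ a := by omega
  · nlinarith
  obtain rfl | hb1 : b = 0 ∨ 1 ≤ b := by omega
  · nlinarith
  obtain ⟨u, rfl⟩ := Nat.exists_eq_add_of_le ha1
  obtain ⟨v, rfl⟩ := Nat.exists_eq_add_of_le hb1
  have := mul_add_le_mul_add_mul (u := u) (v := v) (N := N) (j := j) (by omega)
    (by omega) (by omega)
  nlinarith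

/-- The hypothesis of `exists_bipartite_factor` when the second set consists of `y` and `b` other
vertices, exactly `k` edges are left at `y`, and at most `n - k - 1` pairs are removed off `y`. The
number `σ` counts the edges between `y` and the first set. -/
theorem factor_ineq_of_mem {n k a b r p σ : ℕ} (hk : 2 ≤ k) (hn : 2 * k ≤ n) (ha : a ≤ n)
    (hb : b + 1 ≤ n) (hr : a * b ≤ r + p) (hp : p + k + 1 ≤ n) (hσ : a + k ≤ σ + n) :
    k * (a + (b + 1)) ≤ σ + r + k * n := by
  obtain ⟨j, rfl⟩ := Nat.exists_eq_add_of_le (show 1 ≤ k by omega)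
  obtain ⟨M, rfl⟩ := Nat.exists_eq_add_of_le (show 2 ≤ n by omega)
  obtain rfl | ha1 : a = 0 ∨ 1 ≤ a := by omega
  · nlinarith
  obtain ⟨u, rfl⟩ := Nat.exists_eq_add_of_le ha1
  obtain rfl | hb1 : b = 0 ∨ 1 ≤ b := by omega
  · rcases Nat.lt_or_ge M u with hu | hu
    · obtain rfl : u = M + 1 := by omega
      nlinarith
    · nlinarith
  obtain ⟨v, rfl⟩ := Nat.exists_eq_add_of_le hb1
  rcases Nat.lt_or_ge M u with hu | hu
  · obtain rfl : u = M + 1 := by omega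
    nlinarith
  · have := mul_add_le_mul_add_mul (u := u) (v := v) (N := M) (j := j) hu
      (by omega) (by omega)
    nlinarith

/-! ### Factors of bipartite graphs and Hall's theorem -/

open Finset in
/-- **Bipartite factor theorem** (Ore–Ryser): the bipartite graph with edge set `R ⊆ α × β` contains a
`k`-factor as soon as every `A ⊆ α`, `B ⊆ β` span at least `k * (#A + #B - n)` edges.

Hall's theorem is applied to the assignment of the edges to slots, each vertex `x : α` offering
`deg x - k` slots for unused edges and each vertex `y : β` offering `k` slots for used edges. -/
theorem exists_bipartite_factor {α β : Type*} [Fintype α] [Fintype β] [DecidableEq α]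
    [DecidableEq β] {n k : ℕ} (hα : Fintype.card α = n) (hβ : Fintype.card β = n)
    (R : Finset (α × β)) (h : ∀ A B, k * (#A + #B) ≤ #(R ∩ A ×ˢ B) + k * n) :
    ∃ F ⊆ R, (∀ x, #{e ∈ F | e.1 = x} = k) ∧ ∀ y, #{e ∈ F | e.2 = y} = k := by
  set d : α → ℕ := fun x => #{e ∈ R | e.1 = x} with hd
  have hdA : ∀ A : Finset α, ∑ x ∈ A, d x = #{e ∈ R | e.1 ∈ A} := fun A => by
    rw [card_eq_sum_card_fiberwise (f := Prod.fst) (t := A)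
      (s := {e ∈ R | e.1 ∈ A}) fun e he => (mem_filter.1 he).2]
    refine sum_congr rfl fun x hx => ?_
    rw [filter_filter]
    refine congrArg card (filter_congr fun e he => ?_)
    exact ⟨fun h => ⟨h ▸ hx, h⟩, fun h => h.2⟩
  have hdk : ∀ x, k ≤ d x := fun x => by
    have h1 := h {x} univ
    have h2 : R ∩ {x} ×ˢ (univ : Finset β) = {e ∈ R | e.1 = x} := by
      ext e
      simp only [mem_inter, mem_product, mem_singleton, mem_univ, and_true, mem_filter]
    rw [h2, card_singleton, card_univ, hβ, Nat.mul_add] at h1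
    simp only [hd]
    omega
  let t : R → Finset ((Σ x : α, Fin (d x - k)) ⊕ (β × Fin k)) := fun e =>
    (({e.1.1} : Finset α).sigma fun _ => univ).disjSum ({e.1.2} ×ˢ univ)
  obtain ⟨f, hf, hft⟩ := (all_card_le_biUnion_card_iff_exists_injective t).1 (by
    intro E
    set A := E.image fun e => e.1.1
    set B := E.image fun e => e.1.2
    have hsub : (A.sigma fun _ => univ).disjSum (B ×ˢ univ) ⊆ E.biUnion t := by
      intro s hs
      rw [mem_biUnion]
      rcases s with ⟨x, i⟩ | ⟨y, j⟩
      · obtain ⟨e, he, rfl⟩ := mem_image.1 (by simpa using hs : x ∈ A)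
        exact ⟨e, he, by simp [t]⟩
      · obtain ⟨e, he, rfl⟩ := mem_image.1 (by simpa using hs : y ∈ B)
        exact ⟨e, he, by simp [t]⟩
    refine le_trans ?_ (card_le_card hsub)
    rw [card_disjSum, card_sigma, card_product, card_univ, Fintype.card_fin]
    simp only [card_univ, Fintype.card_fin]
    have hE : #E ≤ #(R ∩ A ×ˢ B) := by
      rw [← card_map (Function.Embedding.subtype _)]
      refine card_le_card fun e he => ?_
      obtain ⟨e, h_e, rfl⟩ := mem_map.1 he
      simp only [mem_inter, mem_product]
      exact ⟨e.2, mem_image.2 ⟨e, h_e, rfl⟩, mem_image.2 ⟨e, h_e, rfl⟩⟩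
    have hsplit : #(R ∩ A ×ˢ B) + #(R ∩ A ×ˢ Bᶜ) = ∑ x ∈ A, d x := by
      rw [hdA, ← card_union_of_disjoint]
      · congr 1
        ext e
        simp only [mem_union, mem_inter, mem_product, mem_compl, mem_filter]
        tauto
      · refine disjoint_left.2 fun e => ?_
        simp only [mem_inter, mem_product, mem_compl]
        tauto
    have hsum : ∑ x ∈ A, (d x - k) + k * #A = ∑ x ∈ A, d x := by
      rw [mul_comm, ← smul_eq_mul, ← sum_const, ← sum_add_distrib]
      exact sum_congr rfl fun x _ => Nat.sub_add_cancel (hdk x)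
    have h1 := h A Bᶜ
    have h2 : k * #B + k * #Bᶜ = k * n := by rw [← Nat.mul_add, card_add_card_compl, hβ]
    rw [Nat.mul_add] at h1
    rw [mul_comm (#B)]
    omega)
  set F : Finset (α × β) := (univ.filter fun e : R => (f e).isRight).map
    (Function.Embedding.subtype _) with hF
  have hFR : F ⊆ R := fun e he => by
    obtain ⟨e, -, rfl⟩ := mem_map.1 he
    exact e.2
  have hy : ∀ y, #{e ∈ F | e.2 = y} ≤ k := fun y => by
    rw [hF, filter_map, card_map]
    calc _ ≤ #((univ : Finset (Fin k)).image fun j => (Sum.inr (y, j) :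
              (Σ x : α, Fin (d x - k)) ⊕ (β × Fin k))) := by
            refine card_le_card_of_injOn f (fun e he => ?_) hf.injOn
            have h2 := hft e
            rw [mem_coe, mem_filter, mem_filter] at he
            have h3 : (f e).isRight ∧ e.1.2 = y := ⟨he.1.2, he.2⟩
            obtain ⟨h3, rfl⟩ := h3
            rcases hfe : f e with ⟨x', i⟩ | ⟨y', j⟩
            · simp [hfe] at h3
            · rw [hfe] at h2
              obtain rfl : e.1.2 = y' := by simpa [t] using h2
              simp
      _ ≤ k := card_image_le.trans (by simp)
  have hx : ∀ x, k ≤ #{e ∈ F | e.1 = x} := fun x => by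
    have h1 : #{e ∈ R \ F | e.1 = x} ≤ d x - k := by
      have : R \ F = (univ.filter fun e : R => (f e).isLeft).map
          (Function.Embedding.subtype _) := by
        ext e
        simp only [hF, mem_sdiff, mem_map, mem_filter, mem_univ, true_and]
        constructor
        · rintro ⟨he, h⟩
          exact ⟨⟨e, he⟩, by_contra fun h' => h ⟨⟨e, he⟩, by simpa using h', rfl⟩, rfl⟩
        · rintro ⟨e, he, rfl⟩
          refine ⟨e.2, ?_⟩
          rintro ⟨e', he', h⟩
          obtain rfl : e' = e := Subtype.ext h
          rcases hfe : f e' <;> simp_all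
      rw [this, filter_map, card_map]
      calc _ ≤ #((univ : Finset (Fin (d x - k))).image fun j => (Sum.inl ⟨x, j⟩ :
              (Σ x : α, Fin (d x - k)) ⊕ (β × Fin k))) := by
            refine card_le_card_of_injOn f (fun e he => ?_) hf.injOn
            have h2 := hft e
            rw [mem_coe, mem_filter, mem_filter] at he
            have h3 : (f e).isLeft ∧ e.1.1 = x := ⟨he.1.2, he.2⟩
            obtain ⟨h3, rfl⟩ := h3
            rcases hfe : f e with ⟨x', i⟩ | ⟨y', j⟩
            · rw [hfe] at h2
              obtain rfl : x' = e.1.1 := by simpa [t] using h2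
              simp
            · simp [hfe] at h3
        _ ≤ d x - k := card_image_le.trans (by simp)
    have h2 : #{e ∈ F | e.1 = x} + #{e ∈ R \ F | e.1 = x} = d x := by
      rw [hd, ← card_union_of_disjoint]
      · rw [← filter_union, union_sdiff_of_subset hFR]
      · exact disjoint_filter_filter disjoint_sdiff
    have := hdk x
    omega
  have hFx : #F = ∑ x, #{e ∈ F | e.1 = x} := card_eq_sum_card_fiberwise (by simp)
  have hFy : #F = ∑ y, #{e ∈ F | e.2 = y} := card_eq_sum_card_fiberwise (by simp)
  have hxs : ∑ x : α, k ≤ ∑ x, #{e ∈ F | e.1 = x} := sum_le_sum fun x _ => hx x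
  have hys : ∑ y, #{e ∈ F | e.2 = y} ≤ ∑ y : β, k := sum_le_sum fun y _ => hy y
  have hk : ∑ x : α, k = ∑ y : β, k := by simp [hα, hβ]
  have hx' := (sum_eq_sum_iff_of_le (s := univ) fun x _ => hx x).1 (by omega)
  have hy' := (sum_eq_sum_iff_of_le (s := univ) fun y _ => hy y).1 (by omega)
  exact ⟨F, hFR, fun x => (hx' x (mem_univ x)).symm, fun y => hy' y (mem_univ y)⟩

open Finset in
/-- Hall's criterion for distributing colours: if `H i` is the set of edges missing in colour `i`,
the edges of `F` can be coloured bijectively unless some set `T` of edges is missing from more than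
`#ι - #T` colours at once. -/
theorem exists_rainbow_equiv {ε ι : Type*} [DecidableEq ε] [Fintype ι] [DecidableEq ι]
    (F : Finset ε) (H : ι → Finset ε) (hF : #F = Fintype.card ι)
    (h : ∀ T ⊆ F, T.Nonempty → #{i | T ⊆ H i} + #T ≤ Fintype.card ι) :
    ∃ φ : F ≃ ι, ∀ e, e.1 ∉ H (φ e) := by
  obtain ⟨f, hf, hft⟩ := (all_card_le_biUnion_card_iff_exists_injective
      fun e : F => ({i | e.1 ∉ H i} : Finset ι)).1 (by
    intro E
    rcases E.eq_empty_or_nonempty with rfl | hE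
    · simp
    have h1 := h (E.map (Function.Embedding.subtype _)) (fun e he => by
      obtain ⟨e, -, rfl⟩ := mem_map.1 he
      exact e.2) (by simpa using hE)
    rw [card_map] at h1
    have h2 : (E.biUnion fun e : F => ({i | e.1 ∉ H i} : Finset ι)) =
        ({i | E.map (Function.Embedding.subtype _) ⊆ H i} : Finset ι)ᶜ := by
      ext i
      simp only [mem_biUnion, mem_filter, mem_univ, true_and, mem_compl, subset_iff, mem_map]
      push Not
      constructor
      · rintro ⟨e, he, hi⟩
        exact ⟨e, ⟨e, he, rfl⟩, hi⟩
      · rintro ⟨_, ⟨e, he, rfl⟩, hi⟩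
        exact ⟨e, he, hi⟩
    rw [h2, card_compl]
    omega)
  refine ⟨Equiv.ofBijective f
    ((Fintype.bijective_iff_injective_and_card f).2 ⟨hf, by simpa using hF⟩), fun e => ?_⟩
  simpa using hft e

/-! ### Popular pairs and rainbow factors -/

open Finset in
/-- The pairs that are missing in at least `(k - 1) * n + 2` of the colours. A set of at most `n - 1`
edges, one of which is not popular, never obstructs a rainbow colouring. -/
def popularPairs {α β ι : Type*} [Fintype α] [Fintype β] [DecidableEq α] [DecidableEq β] [Fintype ι]
    (n k : ℕ) (H : ι → Finset (α × β)) : Finset (α × β) :=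
  {e | (k - 1) * n + 2 ≤ #{i | e ∈ H i}}

open Finset in
theorem card_popularPairs_le {α β ι : Type*} [Fintype α] [Fintype β] [DecidableEq α]
    [DecidableEq β] [Fintype ι] {n k : ℕ} (hk : 2 ≤ k) (hn : 2 * k ≤ n)
    (hι : Fintype.card ι = k * n) (H : ι → Finset (α × β)) (hH : ∀ i, #(H i) ≤ n - 1) :
    #(popularPairs n k H) ≤ 2 * (n - k) := by
  have h1 : #(popularPairs n k H) * ((k - 1) * n + 2) ≤ k * n * (n - 1) := by
    calc #(popularPairs n k H) * ((k - 1) * n + 2)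
        ≤ ∑ e ∈ popularPairs n k H, #{i | e ∈ H i} := by
          rw [← smul_eq_mul, ← sum_const]
          exact sum_le_sum fun e he => (mem_filter.1 he).2
      _ = ∑ i, #{e ∈ popularPairs n k H | e ∈ H i} :=
          sum_card_bipartiteAbove_eq_sum_card_bipartiteBelow (fun e i => e ∈ H i)
      _ ≤ ∑ i : ι, (n - 1) := by
          refine sum_le_sum fun i _ => le_trans (card_le_card fun e he => ?_) (hH i)
          exact (mem_filter.1 he).2
      _ = k * n * (n - 1) := by simp [hι]
  by_contra! h2
  have h3 : (2 * (n - k) + 1) * ((k - 1) * n + 2) ≤ k * n * (n - 1) :=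
    le_trans (Nat.mul_le_mul_right _ h2) h1
  obtain ⟨j, rfl⟩ := Nat.exists_eq_add_of_le hk
  obtain ⟨m, rfl⟩ := Nat.exists_eq_add_of_le hn
  rw [show 2 + j - 1 = j + 1 by omega, show 2 * (2 + j) + m - (2 + j) = 2 + j + m by omega,
    show 2 * (2 + j) + m - 1 = 3 + 2 * j + m by omega] at h3
  nlinarith [Nat.zero_le (j * m), Nat.zero_le (j * j * m), Nat.zero_le (j * m * m)]

open Finset in
/-- A `k`-factor can be coloured as soon as the sets of popular pairs inside it satisfy Hall's
condition. -/
theorem exists_rainbow_equiv_of_popularPairs {α β ι : Type*} [Fintype α] [Fintype β]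
    [DecidableEq α] [DecidableEq β] [Fintype ι] [DecidableEq ι] {n k : ℕ} (hk : 2 ≤ k)
    (hn : 2 * k ≤ n) (hι : Fintype.card ι = k * n) (H : ι → Finset (α × β))
    (hH : ∀ i, #(H i) ≤ n - 1) (F : Finset (α × β)) (hF : #F = k * n)
    (h : ∀ T ⊆ F, T ⊆ popularPairs n k H → T.Nonempty → #{i | T ⊆ H i} + #T ≤ k * n) :
    ∃ φ : F ≃ ι, ∀ e, e.1 ∉ H (φ e) := by
  refine exists_rainbow_equiv F H (hF.trans hι.symm) fun T hTF hT => ?_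
  rw [hι]
  by_cases hTP : T ⊆ popularPairs n k H
  · exact h T hTF hTP hT
  obtain ⟨e, heT, heP⟩ := not_subset.1 hTP
  have h1 : #{i | T ⊆ H i} ≤ #{i | e ∈ H i} :=
    card_le_card fun i hi => by simpa using (mem_filter.1 hi).2 heT
  have h2 : #{i | e ∈ H i} < (k - 1) * n + 2 := by simpa [popularPairs] using heP
  have h3 : (k - 1) * n + n = k * n := by
    rw [← Nat.succ_mul]; congr 1; omega
  rcases ({i | T ⊆ H i} : Finset ι).eq_empty_or_nonempty with h4 | ⟨i, hi⟩
  · rw [h4, card_empty, zero_add, ← hF]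
    exact card_le_card hTF
  · have h4 : #T ≤ n - 1 := (card_le_card (mem_filter.1 hi).2).trans (hH i)
    omega

open Finset in
/-- If no vertex is in more than `n - k` popular pairs, some `k`-factor avoids the popular pairs. -/
theorem exists_rainbow_factor_of_card_le {α β ι : Type*} [Fintype α] [Fintype β]
    [DecidableEq α] [DecidableEq β] [Fintype ι] [DecidableEq ι] {n k : ℕ} (hk : 2 ≤ k)
    (hn : 2 * k ≤ n) (hα : Fintype.card α = n) (hβ : Fintype.card β = n)
    (hι : Fintype.card ι = k * n) (H : ι → Finset (α × β)) (hH : ∀ i, #(H i) ≤ n - 1)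
    (hx : ∀ x, #{e ∈ popularPairs n k H | e.1 = x} ≤ n - k)
    (hy : ∀ y, #{e ∈ popularPairs n k H | e.2 = y} ≤ n - k) :
    ∃ F : Finset (α × β), ((∀ x, #{e ∈ F | e.1 = x} = k) ∧ ∀ y, #{e ∈ F | e.2 = y} = k) ∧
      ∃ φ : F ≃ ι, ∀ e, e.1 ∉ H (φ e) := by
  set P := popularPairs n k H with hP
  obtain ⟨F, hFR, hFx, hFy⟩ := exists_bipartite_factor hα hβ (k := k) Pᶜ (by
    intro A B
    have h1 : #(Pᶜ ∩ A ×ˢ B) + #(P ∩ A ×ˢ B) = #A * #B := by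
      rw [← card_product, inter_comm, inter_comm P, ← sdiff_eq_inter_compl]
      exact card_sdiff_add_card_inter _ _
    have h2 : #(P ∩ A ×ˢ B) ≤ 2 * (n - k) :=
      (card_le_card inter_subset_left).trans (card_popularPairs_le hk hn hι H hH)
    have hA : #A ≤ n := hα ▸ card_le_univ A
    have hB : #B ≤ n := hβ ▸ card_le_univ B
    have hA1 : #A = 1 → #(P ∩ A ×ˢ B) ≤ n - k := fun h => by
      obtain ⟨x, rfl⟩ := card_eq_one.1 h
      refine (card_le_card fun e he => ?_).trans (hx x)
      simp only [mem_inter, mem_product, mem_singleton, mem_filter] at he ⊢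
      tauto
    have hB1 : #B = 1 → #(P ∩ A ×ˢ B) ≤ n - k := fun h => by
      obtain ⟨y, rfl⟩ := card_eq_one.1 h
      refine (card_le_card fun e he => ?_).trans (hy y)
      simp only [mem_inter, mem_product, mem_singleton, mem_filter] at he ⊢
      tauto
    exact factor_ineq hk hn hA hB h1.ge h2 hA1 hB1)
  have hF : #F = k * n := by
    rw [card_eq_sum_card_fiberwise (f := Prod.fst) (t := univ) (by simp)]
    simp [hFx, hα, mul_comm]
  refine ⟨F, ⟨hFx, hFy⟩, exists_rainbow_equiv_of_popularPairs hk hn hι H hH F hF ?_⟩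
  rintro T hTF hTP ⟨e, he⟩
  exact absurd (hTP he) (by simpa using hFR (hTF he))

open Finset in
/-- If the vertex `y` is in more than `n - k` popular pairs, there are at most `n - k - 1` further
popular pairs, and some `k`-factor avoids these. Its `k` edges at `y` can be prescribed arbitrarily;
they are taken to be edges `(s i, y)` present in the distinct colours `i ∈ C`. -/
theorem exists_rainbow_factor_of_lt_card {α β ι : Type*} [Fintype α] [Fintype β]
    [DecidableEq α] [DecidableEq β] [Fintype ι] [DecidableEq ι] {n k : ℕ} (hk : 2 ≤ k)
    (hn : 2 * k ≤ n) (hα : Fintype.card α = n) (hβ : Fintype.card β = n)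
    (hι : Fintype.card ι = k * n) (H : ι → Finset (α × β)) (hH : ∀ i, #(H i) ≤ n - 1)
    (y : β) (hy : n - k < #{e ∈ popularPairs n k H | e.2 = y})
    (hdeg : ∀ i, k - 1 ≤ #{x | (x, y) ∉ H i})
    (hne : ∃ i j, k ≤ #{x | (x, y) ∉ H i ∨ (x, y) ∉ H j}) :
    ∃ F : Finset (α × β), ((∀ x, #{e ∈ F | e.1 = x} = k) ∧ ∀ y, #{e ∈ F | e.2 = y} = k) ∧
      ∃ φ : F ≃ ι, ∀ e, e.1 ∉ H (φ e) := by
  set P := popularPairs n k H with hP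
  obtain ⟨C, hC, s, hs, hsH⟩ : ∃ C : Finset ι, #C = k ∧ ∃ s : C → α, s.Injective ∧
      ∀ i : C, (s i, y) ∉ H i := by
    obtain ⟨i, j, hij⟩ := hne
    obtain ⟨C, hijC, -, hC⟩ := exists_subsuperset_card_eq (n := k) (subset_univ ({i, j} : Finset ι))
      (card_le_two.trans hk) (by rw [card_univ, hι]; nlinarith)
    obtain ⟨s, hs, hsH⟩ := (all_card_le_biUnion_card_iff_exists_injective
        fun i : C => ({x | (x, y) ∉ H i} : Finset α)).1 (by
      intro D
      rcases D.eq_empty_or_nonempty with rfl | ⟨c, hc⟩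
      · simp
      have hDC : #D ≤ k := by simpa [hC] using card_le_univ D
      rcases hDC.lt_or_eq with hD | hD
      · have := (hdeg c).trans (card_le_card (subset_biUnion_of_mem
          (fun i : C => ({x | (x, y) ∉ H i} : Finset α)) hc))
        omega
      · have hD' : D = univ := by rw [← card_eq_iff_eq_univ]; simp [hC, hD]
        rw [hD]
        refine hij.trans (card_le_card fun x hx => ?_)
        rw [mem_biUnion]
        rcases (mem_filter.1 hx).2 with h | h
        · exact ⟨⟨i, hijC (by simp)⟩, by simp [hD'], by simpa using h⟩
        · exact ⟨⟨j, hijC (by simp)⟩, by simp [hD'], by simpa using h⟩)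
    exact ⟨C, hC, s, hs, fun i => by simpa using hsH i⟩
  set S : Finset α := univ.image s with hS
  have hSk : #S = k := by rw [hS, card_image_of_injective _ hs]; simp [hC]
  have hQ : #{e ∈ P | e.2 ≠ y} + 1 ≤ n - k := by
    have h1 := card_filter_add_card_filter_not (s := P) (fun e => e.2 = y)
    have h2 := card_popularPairs_le hk hn hι H hH
    simp only [← hP] at h1 h2 ⊢
    simp only [ne_eq]
    omega
  set R : Finset (α × β) := {e | if e.2 = y then e.1 ∈ S else e ∉ P} with hR
  obtain ⟨F, hFR, hFx, hFy⟩ := exists_bipartite_factor hα hβ (k := k) R (by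
    intro A B
    have h1 : #(A ∩ S) + n ≥ #A + k := by
      have := card_union_add_card_inter A S
      have := card_le_univ (A ∪ S)
      omega
    have h2 : ∀ B : Finset β, y ∉ B → #A * #B ≤ #(R ∩ A ×ˢ B) + #({e ∈ P | e.2 ≠ y} ∩ A ×ˢ B) := by
      intro B hB
      rw [← card_product]
      refine (card_le_card fun e he => ?_).trans (card_union_le _ _)
      have : e.2 ≠ y := fun h => hB (h ▸ (mem_product.1 he).2)
      simp only [mem_union, mem_inter, he, hR, mem_filter, mem_univ, this, if_false]
      tauto
    have h3 : ∀ B : Finset β, #({e ∈ P | e.2 ≠ y} ∩ A ×ˢ B) ≤ #{e ∈ P | e.2 ≠ y} := fun B =>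
      card_le_card inter_subset_left
    have hA : #A ≤ n := hα ▸ card_le_univ A
    by_cases hyB : y ∈ B
    · have h4 : #(A ∩ S) + #(R ∩ A ×ˢ B.erase y) ≤ #(R ∩ A ×ˢ B) := by
        rw [← card_map ⟨fun x => (x, y), fun a b h => (Prod.ext_iff.1 h).1⟩,
          ← card_union_of_disjoint]
        · refine card_le_card fun e he => ?_
          rcases mem_union.1 he with he | he
          · obtain ⟨x, hx, rfl⟩ := mem_map.1 he
            simp only [mem_inter, mem_product, hR, mem_filter, mem_univ, true_and] at hx ⊢
            exact ⟨(if_pos rfl).mpr hx.2, hx.1, hyB⟩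
          · simp only [mem_inter, mem_product, mem_erase] at he ⊢
            tauto
        · refine disjoint_left.2 fun e he => ?_
          obtain ⟨x, hx, rfl⟩ := mem_map.1 he
          exact fun h => (mem_erase.1 (mem_product.1 (mem_inter.1 h).2).2).1 rfl
      have h5 := card_erase_add_one hyB
      have h6 := h2 (B.erase y) (by simp)
      have h7 := h3 (B.erase y)
      have hB : #B ≤ n := hβ ▸ card_le_univ B
      rw [← h5] at hB ⊢
      have := factor_ineq_of_mem (a := #A) (b := #(B.erase y)) hk hn hA (by omega) h6 (by omega) h1
      omega
    · have h6 := h2 B hyB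
      have h7 := h3 B
      have hB : #B + 1 ≤ n := by
        rw [← card_insert_of_notMem hyB, ← hβ]
        exact card_le_univ _
      exact factor_ineq_of_notMem (by omega) (by omega) hA hB h6 (by omega))
  have hF : #F = k * n := by
    rw [card_eq_sum_card_fiberwise (f := Prod.fst) (t := univ) (by simp)]
    simp [hFx, hα, mul_comm]
  refine ⟨F, ⟨hFx, hFy⟩, exists_rainbow_equiv_of_popularPairs hk hn hι H hH F hF ?_⟩
  intro T hTF hTP hT
  -- the colours assigned to the edges of `T` by the matching `s` all contain an edge of `T`
  have hTS : ∀ e ∈ T, e.2 = y ∧ e.1 ∈ S := fun e he => by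
    have h1 : if e.2 = y then e.1 ∈ S else e ∉ P := by simpa [hR] using hFR (hTF he)
    split_ifs at h1 with h2
    · exact ⟨h2, h1⟩
    · exact absurd (hTP he) h1
  have h1 : T ⊆ (univ.filter fun i : C => (s i, y) ∈ T).image fun i => (s i, y) := fun e he => by
    obtain ⟨h1, h2⟩ := hTS e he
    obtain ⟨i, -, hi⟩ := mem_image.1 h2
    obtain rfl : (s i, y) = e := Prod.ext hi h1.symm
    exact mem_image_of_mem (fun i => (s i, y)) (mem_filter.2 ⟨mem_univ i, he⟩)
  have h2 : #T ≤ #(({i | T ⊆ H i} : Finset ι)ᶜ) := by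
    refine ((card_le_card h1).trans card_image_le).trans ?_
    rw [← card_map (Function.Embedding.subtype _)]
    refine card_le_card fun i hi => ?_
    obtain ⟨i, h_i, rfl⟩ := mem_map.1 hi
    simp only [mem_compl, mem_filter, mem_univ, true_and]
    exact fun h => hsH i (h (mem_filter.1 h_i).2)
  have h3 := card_add_card_compl ({i | T ⊆ H i} : Finset ι)
  rw [hι] at h3
  omega

open Finset in
/-- The combinatorial core: each colour misses at most `n - 1` pairs and leaves at least `k - 1` edges
at every vertex, and no vertex has the same `k - 1` neighbours in all colours. -/
theorem exists_rainbow_factor {α β ι : Type*} [Fintype α] [Fintype β]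
    [DecidableEq α] [DecidableEq β] [Fintype ι] [DecidableEq ι] {n k : ℕ} (hk : 2 ≤ k)
    (hn : 2 * k ≤ n) (hα : Fintype.card α = n) (hβ : Fintype.card β = n)
    (hι : Fintype.card ι = k * n) (H : ι → Finset (α × β)) (hH : ∀ i, #(H i) ≤ n - 1)
    (hdegα : ∀ x i, k - 1 ≤ #{y | (x, y) ∉ H i})
    (hdegβ : ∀ y i, k - 1 ≤ #{x | (x, y) ∉ H i})
    (hneα : ∀ x, ∃ i j, k ≤ #{y | (x, y) ∉ H i ∨ (x, y) ∉ H j})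
    (hneβ : ∀ y, ∃ i j, k ≤ #{x | (x, y) ∉ H i ∨ (x, y) ∉ H j}) :
    ∃ F : Finset (α × β), ((∀ x, #{e ∈ F | e.1 = x} = k) ∧ ∀ y, #{e ∈ F | e.2 = y} = k) ∧
      ∃ φ : F ≃ ι, ∀ e, e.1 ∉ H (φ e) := by
  by_cases hy : ∀ y, #{e ∈ popularPairs n k H | e.2 = y} ≤ n - k
  swap
  · push Not at hy
    obtain ⟨y, hy⟩ := hy
    exact exists_rainbow_factor_of_lt_card hk hn hα hβ hι H hH y hy (hdegβ y) (hneβ y)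
  by_cases hx : ∀ x, #{e ∈ popularPairs n k H | e.1 = x} ≤ n - k
  · exact exists_rainbow_factor_of_card_le hk hn hα hβ hι H hH hx hy
  push Not at hx
  obtain ⟨x, hx⟩ := hx
  -- exchange the roles of the two sides
  let σ : β × α ≃ α × β := Equiv.prodComm β α
  let H' : ι → Finset (β × α) := fun i => (H i).map σ.symm.toEmbedding
  have hmem : ∀ i e, e ∈ H' i ↔ σ e ∈ H i := fun i e => by
    simp only [H', mem_map_equiv, Equiv.symm_symm]
  have hpop : ∀ e, e ∈ popularPairs n k H' ↔ σ e ∈ popularPairs n k H := fun e => by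
    simp only [popularPairs, mem_filter, mem_univ, true_and, hmem]
  obtain ⟨F, ⟨hFx, hFy⟩, φ, hφ⟩ := exists_rainbow_factor_of_lt_card hk hn hβ hα hι H'
    (fun i => by simpa [H'] using hH i) x (by
      refine hx.trans_le ?_
      rw [← card_map σ.symm.toEmbedding]
      refine card_le_card fun e he => ?_
      have h1 : σ e ∈ popularPairs n k H ∧ (σ e).1 = x := by
        simpa only [mem_map_equiv, Equiv.symm_symm, mem_filter] using he
      exact mem_filter.2 ⟨(hpop e).2 h1.1, h1.2⟩)
    (fun i => by simpa only [hmem] using! hdegα x i) (by simpa only [hmem] using! hneα x)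
  refine ⟨F.map σ.toEmbedding, ⟨fun x => ?_, fun y => ?_⟩,
    (F.equivMap σ.toEmbedding).symm.trans φ, fun e => ?_⟩
  · rw [filter_map, card_map]
    exact hFy x
  · rw [filter_map, card_map]
    exact hFx y
  · obtain ⟨e, rfl⟩ := (F.equivMap σ.toEmbedding).surjective e
    have := hφ e
    rw [hmem] at this
    simpa using this

/-! ### The spectral radius of a graph -/

open Matrix in
theorem Matrix.IsHermitian.exists_eigenvector_spectralRadius {V : Type*} [Fintype V]
    [DecidableEq V] [Nonempty V] {A : Matrix V V ℝ} (hA : A.IsHermitian) :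
    ∃ (c : ℝ) (z : V → ℝ), z ≠ 0 ∧ A *ᵥ z = c • z ∧ spectralRadius ℝ A = ‖c‖₊ := by
  have hne : (spectrum ℝ A).Nonempty := by
    rw [hA.spectrum_real_eq_range_eigenvalues]
    exact Set.range_nonempty _
  have hfin : (spectrum ℝ A).Finite := by
    rw [hA.spectrum_real_eq_range_eigenvalues]
    exact Set.finite_range _
  obtain ⟨c, hc, hmax⟩ := hfin.exists_maximalFor (fun c => ‖c‖₊) _ hne
  have hc' := hc
  rw [← Matrix.spectrum_toLin', ← Module.End.hasEigenvalue_iff_mem_spectrum] at hc'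
  obtain ⟨z, hz⟩ := hc'.exists_hasEigenvector
  refine ⟨c, z, hz.2, by simpa using hz.apply_eq_smul, le_antisymm (iSup₂_le fun b hb => ?_)
    (le_iSup₂ (f := fun k (_ : k ∈ spectrum ℝ A) => (‖k‖₊ : ENNReal)) c hc)⟩
  rcases le_total ‖b‖₊ ‖c‖₊ with h | h
  · exact_mod_cast h
  · exact_mod_cast hmax hb h

open Matrix in
theorem Matrix.IsHermitian.posSemidef_smul_one_sub {V : Type*} [Fintype V]
    [DecidableEq V] {A : Matrix V V ℝ} (hA : A.IsHermitian) {r : ℝ}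
    (hr : ∀ b ∈ spectrum ℝ A, b ≤ r) : (r • (1 : Matrix V V ℝ) - A).PosSemidef := by
  refine posSemidef_iff_isHermitian_and_spectrum_nonneg.2 ⟨?_, ?_⟩
  · exact (isHermitian_one.smul (IsSelfAdjoint.all r)).sub hA
  · rw [← Algebra.algebraMap_eq_smul_one, ← spectrum.singleton_sub_eq]
    rintro _ ⟨_, rfl, b, hb, rfl⟩
    exact sub_nonneg.2 (hr b hb)

open Classical in
/-- The adjacency matrix over `ℝ`, with the same (classical) decidability instances as in
`graphSpectralRadius`. -/
noncomputable def realAdjMatrix {V : Type*} (G : SimpleGraph V) : Matrix V V ℝ :=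
  G.adjMatrix ℝ

/-- The spectral radius of a graph as a real number. -/
noncomputable def realSpectralRadius {V : Type*} [Fintype V] (G : SimpleGraph V) : ℝ :=
  (graphSpectralRadius G).toReal

theorem isHermitian_realAdjMatrix {V : Type*} (G : SimpleGraph V) :
    (realAdjMatrix G).IsHermitian := by
  ext u v
  by_cases h : G.Adj u v
  · simp [realAdjMatrix, h, h.symm]
  · simp [realAdjMatrix, h, mt SimpleGraph.Adj.symm h]

theorem realAdjMatrix_nonneg {V : Type*} (G : SimpleGraph V) (u v : V) :
    0 ≤ realAdjMatrix G u v := by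
  simp only [realAdjMatrix, SimpleGraph.adjMatrix_apply]
  split_ifs <;> norm_num

open Classical in
theorem spectralRadius_realAdjMatrix {V : Type*} [Fintype V] (G : SimpleGraph V) :
    spectralRadius ℝ (realAdjMatrix G) = graphSpectralRadius G := by
  rw [graphSpectralRadius, realAdjMatrix]

open Classical in
theorem graphSpectralRadius_ne_top {V : Type*} [Fintype V] (G : SimpleGraph V) :
    graphSpectralRadius G ≠ ⊤ := by
  rw [← spectralRadius_realAdjMatrix]
  rcases isEmpty_or_nonempty V with h | h
  · simp [spectralRadius, spectrum.of_subsingleton]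
  · obtain ⟨c, z, -, -, hc⟩ := (isHermitian_realAdjMatrix G).exists_eigenvector_spectralRadius
    rw [hc]
    exact ENNReal.coe_ne_top

theorem realSpectralRadius_le_iff {V W : Type*} [Fintype V] [Fintype W] (G : SimpleGraph V)
    (H : SimpleGraph W) :
    realSpectralRadius G ≤ realSpectralRadius H ↔ graphSpectralRadius G ≤ graphSpectralRadius H :=
  ENNReal.toReal_le_toReal (graphSpectralRadius_ne_top G) (graphSpectralRadius_ne_top H)

theorem realSpectralRadius_nonneg {V : Type*} [Fintype V] (G : SimpleGraph V) :
    0 ≤ realSpectralRadius G :=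
  ENNReal.toReal_nonneg

open Classical in
theorem abs_le_realSpectralRadius {V : Type*} [Fintype V] (G : SimpleGraph V) {b : ℝ}
    (hb : b ∈ spectrum ℝ (realAdjMatrix G)) : |b| ≤ realSpectralRadius G := by
  have h1 : (‖b‖₊ : ENNReal) ≤ graphSpectralRadius G := by
    rw [← spectralRadius_realAdjMatrix]
    exact le_iSup₂ (f := fun k (_ : k ∈ spectrum ℝ (realAdjMatrix G)) => (‖k‖₊ : ENNReal)) b hb
  exact ENNReal.toReal_mono (graphSpectralRadius_ne_top G) h1

open Matrix in
theorem exists_eigenvector_realSpectralRadius {V : Type*} [Fintype V] [Nonempty V]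
    (G : SimpleGraph V) : ∃ (c : ℝ) (z : V → ℝ), z ≠ 0 ∧ realAdjMatrix G *ᵥ z = c • z ∧
      |c| = realSpectralRadius G := by
  classical
  obtain ⟨c, z, hz, hcz, hc⟩ := (isHermitian_realAdjMatrix G).exists_eigenvector_spectralRadius
  refine ⟨c, z, hz, hcz, ?_⟩
  rw [realSpectralRadius, ← spectralRadius_realAdjMatrix]
  convert! (congrArg ENNReal.toReal hc).symm

open Classical Matrix in
theorem posSemidef_realSpectralRadius_sub {V : Type*} [Fintype V] (G : SimpleGraph V) :
    (realSpectralRadius G • (1 : Matrix V V ℝ) - realAdjMatrix G).PosSemidef :=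
  (isHermitian_realAdjMatrix G).posSemidef_smul_one_sub fun _ hb =>
    (le_abs_self _).trans (abs_le_realSpectralRadius G hb)

open Classical Matrix in
theorem posSemidef_realSpectralRadius_add {V : Type*} [Fintype V] (G : SimpleGraph V) :
    (realSpectralRadius G • (1 : Matrix V V ℝ) + realAdjMatrix G).PosSemidef := by
  rw [← sub_neg_eq_add]
  refine (isHermitian_realAdjMatrix G).neg.posSemidef_smul_one_sub fun b hb => ?_
  rw [← spectrum.neg_eq, Set.mem_neg] at hb
  exact (le_abs_self b).trans (abs_neg b ▸ abs_le_realSpectralRadius G hb)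

open Matrix in
theorem dotProduct_realAdjMatrix_le {V : Type*} [Fintype V] (G : SimpleGraph V) (w : V → ℝ) :
    w ⬝ᵥ (realAdjMatrix G *ᵥ w) ≤ realSpectralRadius G * (w ⬝ᵥ w) := by
  classical
  have := (posSemidef_realSpectralRadius_sub G).dotProduct_mulVec_nonneg w
  simp only [sub_mulVec, dotProduct_sub, smul_mulVec, one_mulVec, dotProduct_smul, smul_eq_mul,
    star_trivial] at this
  linarith

open Matrix in
theorem neg_le_dotProduct_realAdjMatrix {V : Type*} [Fintype V] (G : SimpleGraph V) (w : V → ℝ) :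
    -(realSpectralRadius G * (w ⬝ᵥ w)) ≤ w ⬝ᵥ (realAdjMatrix G *ᵥ w) := by
  classical
  have := (posSemidef_realSpectralRadius_add G).dotProduct_mulVec_nonneg w
  simp only [add_mulVec, dotProduct_add, smul_mulVec, one_mulVec, dotProduct_smul, smul_eq_mul,
    star_trivial] at this
  linarith

open Matrix in
/-- A vector maximising the Rayleigh quotient is an eigenvector. -/
theorem realAdjMatrix_mulVec_eq_of_le {V : Type*} [Fintype V] (G : SimpleGraph V) (w : V → ℝ)
    (h : realSpectralRadius G * (w ⬝ᵥ w) ≤ w ⬝ᵥ (realAdjMatrix G *ᵥ w)) :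
    realAdjMatrix G *ᵥ w = realSpectralRadius G • w := by
  classical
  have h1 := (posSemidef_realSpectralRadius_sub G).dotProduct_mulVec_zero_iff w
  have h2 := dotProduct_realAdjMatrix_le G w
  simp only [sub_mulVec, dotProduct_sub, smul_mulVec, one_mulVec, dotProduct_smul, smul_eq_mul,
    star_trivial] at h1
  exact (sub_eq_zero.1 (h1.1 (by linarith))).symm

open Matrix in
theorem dotProduct_mulVec_comm_realAdjMatrix {V : Type*} [Fintype V] (G : SimpleGraph V)
    (u w : V → ℝ) : u ⬝ᵥ (realAdjMatrix G *ᵥ w) = w ⬝ᵥ (realAdjMatrix G *ᵥ u) := by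
  rw [dotProduct_mulVec, dotProduct_comm, ← mulVec_transpose]
  congr 2
  simpa [IsHermitian] using isHermitian_realAdjMatrix G

open Matrix in
/-- The spectral radius bounds the operator norm of the adjacency matrix. For `u = A w` and `ρ ≠ 0`
this is the sum of the Rayleigh bounds `z ⬝ᵥ A z ≤ ρ (z ⬝ᵥ z)` at `z = ρ w + u` and
`-ρ (z ⬝ᵥ z) ≤ z ⬝ᵥ A z` at `z = ρ w - u`. -/
theorem mulVec_dotProduct_mulVec_le {V : Type*} [Fintype V] (G : SimpleGraph V) (w : V → ℝ) :
    (realAdjMatrix G *ᵥ w) ⬝ᵥ (realAdjMatrix G *ᵥ w) ≤ realSpectralRadius G ^ 2 * (w ⬝ᵥ w) := by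
  set r := realSpectralRadius G with hr
  set u := realAdjMatrix G *ᵥ w with hu
  rcases (realSpectralRadius_nonneg G).eq_or_lt with h0 | h0
  · have h1 := neg_le_dotProduct_realAdjMatrix G w
    have h2 := realAdjMatrix_mulVec_eq_of_le G w (by rw [← h0] at h1 ⊢; linarith)
    rw [← hu, ← h0, zero_smul] at h2
    rw [h2, dotProduct_zero, hr, ← h0]
    simp
  · have h1 := dotProduct_realAdjMatrix_le G (r • w + u)
    have h2 := neg_le_dotProduct_realAdjMatrix G (r • w - u)
    have h3 := dotProduct_mulVec_comm_realAdjMatrix G w u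
    simp only [mulVec_add, mulVec_sub, mulVec_smul, dotProduct_add, add_dotProduct,
      dotProduct_sub, sub_dotProduct, dotProduct_smul, smul_dotProduct, smul_eq_mul, ← hu,
      ← hr, h3, dotProduct_comm w u] at h1 h2
    have h4 : 0 ≤ r * (r ^ 2 * (w ⬝ᵥ w) - u ⬝ᵥ u) := by nlinarith
    have := nonneg_of_mul_nonneg_right h4 h0
    linarith

open Matrix in
/-- The spectral radius strictly increases when edges are added to obtain a connected graph: the
absolute values of a top eigenvector of the smaller graph form a Perron vector of the larger one,
which is positive by connectedness. -/
theorem eq_of_le_of_realSpectralRadius_le {V : Type*} [Fintype V] {G H : SimpleGraph V}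
    (hGH : G ≤ H) (hH : H.Connected) (hle : realSpectralRadius H ≤ realSpectralRadius G) :
    G = H := by
  classical
  have := hH.nonempty
  obtain ⟨c, z, hz, hcz, hc⟩ := exists_eigenvector_realSpectralRadius G
  set w : V → ℝ := fun v => |z v| with hw
  have hw0 : ∀ v, 0 ≤ w v := fun v => abs_nonneg _
  have hww : w ⬝ᵥ w = z ⬝ᵥ z := by simp [hw, dotProduct]
  have hexp : ∀ (A : Matrix V V ℝ) (u : V → ℝ),
      u ⬝ᵥ (A *ᵥ u) = ∑ i, ∑ j, u i * (A i j * u j) := fun A u => by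
    simp [dotProduct, mulVec, Finset.mul_sum]
  have h1 : realSpectralRadius G * (w ⬝ᵥ w) ≤ w ⬝ᵥ (realAdjMatrix G *ᵥ w) := by
    have hzz : 0 ≤ z ⬝ᵥ z := Finset.sum_nonneg fun i _ => mul_self_nonneg _
    calc realSpectralRadius G * (w ⬝ᵥ w) = |z ⬝ᵥ (realAdjMatrix G *ᵥ z)| := by
          rw [hcz, dotProduct_smul, smul_eq_mul, abs_mul, hc, hww, abs_of_nonneg hzz]
      _ ≤ w ⬝ᵥ (realAdjMatrix G *ᵥ w) := by
          rw [hexp, hexp]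
          refine (Finset.abs_sum_le_sum_abs _ _).trans (Finset.sum_le_sum fun i _ => ?_)
          refine (Finset.abs_sum_le_sum_abs _ _).trans (Finset.sum_le_sum fun j _ => ?_)
          rw [abs_mul, abs_mul, abs_of_nonneg (realAdjMatrix_nonneg G i j)]
  have hterm : ∀ i j, w i * (realAdjMatrix G i j * w j) ≤ w i * (realAdjMatrix H i j * w j) := by
    intro i j
    refine mul_le_mul_of_nonneg_left (mul_le_mul_of_nonneg_right ?_ (hw0 j)) (hw0 i)
    simp only [realAdjMatrix, SimpleGraph.adjMatrix_apply]
    split_ifs with h h'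
    · exact le_rfl
    · exact absurd (hGH h) h'
    · exact zero_le_one
    · exact le_rfl
  have h2 : w ⬝ᵥ (realAdjMatrix G *ᵥ w) ≤ w ⬝ᵥ (realAdjMatrix H *ᵥ w) := by
    rw [hexp, hexp]
    exact Finset.sum_le_sum fun i _ => Finset.sum_le_sum fun j _ => hterm i j
  have hww0 : 0 ≤ w ⬝ᵥ w := Finset.sum_nonneg fun i _ => mul_self_nonneg _
  have h3 := mul_le_mul_of_nonneg_right hle hww0
  have h4 := dotProduct_realAdjMatrix_le H w
  have h5 := realAdjMatrix_mulVec_eq_of_le H w (by linarith)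
  -- the zero set of `w` is closed under taking neighbours in `H`
  have hstep : ∀ u v, H.Adj u v → w u = 0 → w v = 0 := by
    intro u v huv hu
    have h6 : ∑ j, realAdjMatrix H u j * w j = 0 := by
      have := congrFun h5 u
      simpa [hu, mulVec, dotProduct] using this
    have h7 := (Finset.sum_eq_zero_iff_of_nonneg fun j _ =>
      mul_nonneg (realAdjMatrix_nonneg H u j) (hw0 j)).1 h6 v (Finset.mem_univ v)
    simpa [realAdjMatrix, huv] using h7
  have hpos : ∀ u, 0 < w u := by
    intro u
    refine (hw0 u).lt_of_ne' fun hu => hz (funext fun v => ?_)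
    obtain ⟨p⟩ := hH.preconnected u v
    have hv : w v = 0 := by
      induction p with
      | nil => exact hu
      | cons h p ih => exact ih (hstep _ _ h hu)
    exact abs_eq_zero.1 hv
  refine le_antisymm hGH fun u v huv => by_contra fun hG => ?_
  have h6 : w ⬝ᵥ (realAdjMatrix G *ᵥ w) < w ⬝ᵥ (realAdjMatrix H *ᵥ w) := by
    rw [hexp, hexp]
    refine Finset.sum_lt_sum (fun i _ => Finset.sum_le_sum fun j _ => hterm i j)
      ⟨u, Finset.mem_univ u, Finset.sum_lt_sum (fun j _ => hterm u j) ⟨v, Finset.mem_univ v, ?_⟩⟩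
    simp only [realAdjMatrix, SimpleGraph.adjMatrix_apply, huv, hG, if_true, if_false]
    simpa using mul_pos (hpos u) (hpos v)
  linarith

open Classical Matrix Finset in
/-- In a bipartite graph, `ρ ^ 2` is at most the number of edges. -/
theorem realSpectralRadius_sq_le {V : Type*} [Fintype V] {G : SimpleGraph V} {X Y : Finset V}
    (hXY : IsCompl X Y) (hG : G.IsBipartiteWith (X : Set V) (Y : Set V)) :
    realSpectralRadius G ^ 2 ≤ ∑ x ∈ X, (G.degree x : ℝ) := by
  rcases isEmpty_or_nonempty V with h | h
  · simp [realSpectralRadius, graphSpectralRadius, spectralRadius, spectrum.of_subsingleton]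
  obtain ⟨c, z, hz, hcz, hc⟩ := exists_eigenvector_realSpectralRadius G
  have key : ∀ X Y : Finset V, G.IsBipartiteWith (X : Set V) (Y : Set V) →
      c ^ 2 * ∑ x ∈ X, z x ^ 2 ≤ (∑ x ∈ X, (G.degree x : ℝ)) * ∑ y ∈ Y, z y ^ 2 := by
    intro X Y hG
    rw [mul_sum, sum_mul]
    refine sum_le_sum fun x hx => ?_
    have h1 : c * z x = ∑ y ∈ G.neighborFinset x, z y := by
      have h2 := congrFun hcz x
      rw [realAdjMatrix, SimpleGraph.adjMatrix_mulVec_apply] at h2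
      exact h2.symm
    rw [← mul_pow, h1, ← G.card_neighborFinset_eq_degree]
    refine sq_sum_le_card_mul_sum_sq.trans (mul_le_mul_of_nonneg_left ?_ (Nat.cast_nonneg _))
    exact sum_le_sum_of_subset_of_nonneg
      (SimpleGraph.isBipartiteWith_neighborFinset_subset hG hx) fun _ _ _ => sq_nonneg _
  have h1 := key X Y hG
  have h2 := key Y X hG.symm
  have h3 : (∑ y ∈ Y, (G.degree y : ℝ)) = ∑ x ∈ X, (G.degree x : ℝ) := by
    exact_mod_cast (SimpleGraph.isBipartiteWith_sum_degrees_eq hG).symm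
  rw [h3] at h2
  have h4 : ∑ x ∈ X, z x ^ 2 + ∑ y ∈ Y, z y ^ 2 = ∑ v, z v ^ 2 := by
    rw [← sum_union hXY.disjoint]
    exact congrArg (fun s => ∑ v ∈ s, z v ^ 2) hXY.sup_eq_top
  have h5 : 0 < ∑ v, z v ^ 2 := by
    obtain ⟨v, hv⟩ := Function.ne_iff.1 hz
    exact sum_pos' (fun _ _ => sq_nonneg _) ⟨v, mem_univ v, by
      have hv' : z v ≠ 0 := hv
      positivity⟩
  rw [← hc, sq_abs]
  refine le_of_mul_le_mul_right ?_ h5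
  rw [← h4]
  linarith

open Classical in
theorem graphSpectralRadius_eq_of_iso {V W : Type*} [Fintype V] [Fintype W] {G : SimpleGraph V}
    {H : SimpleGraph W} (e : G ≃g H) : graphSpectralRadius G = graphSpectralRadius H := by
  rw [← spectralRadius_realAdjMatrix, ← spectralRadius_realAdjMatrix, spectralRadius,
    spectralRadius]
  have h1 : realAdjMatrix H = Matrix.reindexAlgEquiv ℝ ℝ e.toEquiv (realAdjMatrix G) := by
    ext u v
    by_cases h : H.Adj u v
    · have h' : G.Adj (e.symm u) (e.symm v) := e.symm.map_adj_iff.2 h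
      simpa [realAdjMatrix, h] using! h'
    · have h' : ¬ G.Adj (e.symm u) (e.symm v) := mt e.symm.map_adj_iff.1 h
      simpa [realAdjMatrix, h] using! h'
  rw [h1, AlgEquiv.spectrum_eq]

/-! ### The extremal graph -/

/-- The complete bipartite graph with parts `X` and `Y` in which the neighbourhood of the one vertex
`y` is cut down to `D`. For `y ∈ Y`, `D ⊆ X`, `#X = #Y = n` and `#D = k - 1` this is a copy of
`extremalGraph n k`. -/
def starDeletedGraph {V : Type*} (X Y : Finset V) (y : V) (D : Finset V) : SimpleGraph V :=
  SimpleGraph.fromRel fun u v => u ∈ X ∧ v ∈ Y ∧ (v = y → u ∈ D)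

section

variable {V : Type*} [Fintype V] {X Y D : Finset V} {y : V} {n k : ℕ}

theorem starDeletedGraph_adj [DecidableEq V] (hXY : IsCompl X Y) (y : V) (D : Finset V) (u v : V) :
    (starDeletedGraph X Y y D).Adj u v ↔
      (u ∈ X ∧ v ∈ Y ∧ (v = y → u ∈ D)) ∨ (v ∈ X ∧ u ∈ Y ∧ (u = y → v ∈ D)) := by
  have h := Finset.disjoint_left.1 hXY.disjoint
  rw [starDeletedGraph, SimpleGraph.fromRel_adj]
  refine ⟨fun h => h.2, fun h' => ⟨?_, h'⟩⟩
  rintro rfl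
  rcases h' with h' | h' <;> exact h h'.1 h'.2.1

theorem starDeletedGraph_isBipartiteWith [DecidableEq V] (hXY : IsCompl X Y) (y : V)
    (D : Finset V) :
    (starDeletedGraph X Y y D).IsBipartiteWith (X : Set V) (Y : Set V) where
  disjoint := Finset.disjoint_coe.2 hXY.disjoint
  mem_of_adj u v h := by
    rw [starDeletedGraph_adj hXY] at h
    simp only [Finset.mem_coe]
    tauto

theorem union_eq_univ_of_isCompl [DecidableEq V] (hXY : IsCompl X Y) : X ∪ Y = Finset.univ :=
  hXY.sup_eq_top

theorem mem_or_mem_of_isCompl [DecidableEq V] (hXY : IsCompl X Y) (v : V) : v ∈ X ∨ v ∈ Y := by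
  rw [← Finset.mem_union, union_eq_univ_of_isCompl hXY]
  exact Finset.mem_univ v

theorem card_add_card_of_isCompl [DecidableEq V] (hXY : IsCompl X Y) :
    X.card + Y.card = Fintype.card V := by
  rw [← Finset.card_union_of_disjoint hXY.disjoint, union_eq_univ_of_isCompl hXY, Finset.card_univ]

open Classical in
theorem le_starDeletedGraph (hXY : IsCompl X Y) {G : SimpleGraph V}
    (hG : G.IsBipartiteWith (X : Set V) (Y : Set V)) (hD : G.neighborFinset y ⊆ D) :
    G ≤ starDeletedGraph X Y y D := by
  intro u v huv
  rw [starDeletedGraph_adj hXY]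
  rcases hG.mem_of_adj huv with h | h
  · refine Or.inl ⟨h.1, h.2, ?_⟩
    rintro rfl
    exact hD (by simpa using huv.symm)
  · refine Or.inr ⟨h.2, h.1, ?_⟩
    rintro rfl
    exact hD (by simpa using huv)

open Classical in
theorem neighborFinset_starDeletedGraph (hXY : IsCompl X Y) (hD : D ⊆ X) {v : V} (hv : v ∈ Y) :
    (starDeletedGraph X Y y D).neighborFinset v = if v = y then D else X := by
  have hvX : v ∉ X := fun h => Finset.disjoint_left.1 hXY.disjoint h hv
  ext u
  rw [SimpleGraph.mem_neighborFinset, starDeletedGraph_adj hXY]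
  split_ifs with h
  · have := @hD u
    tauto
  · tauto

theorem starDeletedGraph_connected [DecidableEq V] (hXY : IsCompl X Y) (hD : D ⊆ X)
    (hD0 : D.Nonempty) (hY : ∃ y' ∈ Y, y' ≠ y) : (starDeletedGraph X Y y D).Connected := by
  obtain ⟨d, hd⟩ := hD0
  obtain ⟨y', hy', hne⟩ := hY
  have hadj := starDeletedGraph_adj hXY y D
  have h1 : ∀ v ∈ Y, (starDeletedGraph X Y y D).Adj d v := fun v hv =>
    (hadj d v).2 (Or.inl ⟨hD hd, hv, fun _ => hd⟩)
  have h2 : ∀ v ∈ X, (starDeletedGraph X Y y D).Adj y' v := fun v hv =>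
    (hadj y' v).2 (Or.inr ⟨hv, hy', fun h => absurd h hne⟩)
  refine SimpleGraph.connected_iff_exists_forall_reachable _ |>.2 ⟨d, fun v => ?_⟩
  rcases mem_or_mem_of_isCompl hXY v with hv | hv
  · exact (h1 y' hy').reachable.trans (h2 v hv).reachable
  · exact (h1 v hv).reachable

open Classical Matrix Finset in
/-- The operator norm bound at the indicator function of `X`, which the adjacency matrix maps to `n`
on `Y \ {y}` and to `#D` at `y`. -/
theorem lt_realSpectralRadius_starDeletedGraph_sq (hXY : IsCompl X Y) (hX : #X = n) (hY : #Y = n)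
    (hn : 1 ≤ n) (hy : y ∈ Y) (hD : D ⊆ X) (hD0 : D.Nonempty) :
    (n : ℝ) * (n - 1) < realSpectralRadius (starDeletedGraph X Y y D) ^ 2 := by
  set B := starDeletedGraph X Y y D
  set w : V → ℝ := fun v => if v ∈ X then 1 else 0
  have hw : w ⬝ᵥ w = n := by
    simp [w, dotProduct, hX]
  have hAw : ∀ v ∈ Y, (realAdjMatrix B *ᵥ w) v = if v = y then (#D : ℝ) else n := by
    intro v hv
    rw [realAdjMatrix, SimpleGraph.adjMatrix_mulVec_apply, neighborFinset_starDeletedGraph hXY hD hv]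
    split_ifs with h
    · rw [sum_congr rfl fun u hu => if_pos (hD hu)]
      simp
    · rw [sum_congr rfl fun u hu => if_pos hu]
      simp [hX]
  have h1 : ∑ v ∈ Y, (realAdjMatrix B *ᵥ w) v * (realAdjMatrix B *ᵥ w) v ≤
      (realAdjMatrix B *ᵥ w) ⬝ᵥ (realAdjMatrix B *ᵥ w) :=
    sum_le_sum_of_subset_of_nonneg (subset_univ Y) fun _ _ _ => mul_self_nonneg _
  have h2 : ∑ v ∈ Y.erase y, (realAdjMatrix B *ᵥ w) v * (realAdjMatrix B *ᵥ w) v =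
      ((n : ℝ) - 1) * (n * n) := by
    rw [sum_congr rfl fun v hv => by rw [hAw v (mem_of_mem_erase hv), if_neg (ne_of_mem_erase hv)],
      sum_const, card_erase_of_mem hy, hY, nsmul_eq_mul, Nat.cast_sub hn, Nat.cast_one]
  rw [← add_sum_erase Y _ hy, h2, hAw y hy, if_pos rfl] at h1
  have h3 := mulVec_dotProduct_mulVec_le B w
  rw [hw] at h3
  have h4 : (1 : ℝ) ≤ #D := by exact_mod_cast hD0.card_pos
  have h5 : (1 : ℝ) ≤ n := by exact_mod_cast hn
  by_contra! h6
  have h7 := mul_le_mul_of_nonneg_right h6 (show (0 : ℝ) ≤ n by linarith)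
  nlinarith

open Finset in
theorem nonempty_iso_extremalGraph [DecidableEq V] (hXY : IsCompl X Y) (hX : #X = n) (hY : #Y = n)
    (hk : 1 ≤ k) (hkn : k ≤ n) (hy : y ∈ Y) (hD : D ⊆ X) (hDk : #D = k - 1) :
    Nonempty (starDeletedGraph X Y y D ≃g extremalGraph n k) := by
  have hdisj := disjoint_left.1 hXY.disjoint
  let eD : Fin (k - 1) ≃ D := (D.equivFinOfCardEq hDk).symm
  let eY : Fin (n - 1) ≃ Y.erase y := ((Y.erase y).equivFinOfCardEq (by
    rw [card_erase_of_mem hy, hY])).symm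
  let eX : Fin (n - k + 1) ≃ (X \ D : Finset V) := ((X \ D).equivFinOfCardEq (by
    rw [card_sdiff_of_subset hD]; omega)).symm
  have hDm : ∀ i, (eD i : V) ∈ D := fun i => (eD i).2
  have hYm : ∀ i, (eY i : V) ≠ y ∧ (eY i : V) ∈ Y := fun i => mem_erase.1 (eY i).2
  have hXm : ∀ i, (eX i : V) ∈ X ∧ (eX i : V) ∉ D := fun i => mem_sdiff.1 (eX i).2
  let f : (Fin (k - 1) ⊕ Fin (n - 1)) ⊕ (Fin (n - k + 1) ⊕ Fin 1) → V :=
    Sum.elim (Sum.elim (fun i => eD i) fun i => eY i) (Sum.elim (fun i => eX i) fun _ => y)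
  have hf : f.Surjective := by
    intro v
    rcases mem_or_mem_of_isCompl hXY v with hv | hv
    · by_cases hvD : v ∈ D
      · exact ⟨Sum.inl (Sum.inl (eD.symm ⟨v, hvD⟩)), by simp [f]⟩
      · exact ⟨Sum.inr (Sum.inl (eX.symm ⟨v, mem_sdiff.2 ⟨hv, hvD⟩⟩)), by simp [f]⟩
    · by_cases hvy : v = y
      · exact ⟨Sum.inr (Sum.inr 0), by simp [f, hvy]⟩
      · exact ⟨Sum.inl (Sum.inr (eY.symm ⟨v, mem_erase.2 ⟨hvy, hv⟩⟩)), by simp [f]⟩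
  have hcard : Fintype.card V = n + n := by
    rw [← card_add_card_of_isCompl hXY, hX, hY]
  have hf' : f.Bijective := (Fintype.bijective_iff_surjective_and_card f).2 ⟨hf, by
    simp only [Fintype.card_sum, Fintype.card_fin, hcard]
    omega⟩
  refine ⟨SimpleGraph.Iso.symm ⟨Equiv.ofBijective f hf', ?_⟩⟩
  have hY' : ∀ i, (eY i : V) ∉ X := fun i h => hdisj h (hYm i).2
  have hX' : ∀ i, (eX i : V) ∉ Y := fun i => hdisj (hXm i).1
  have hDX : ∀ i, (eD i : V) ∈ X := fun i => hD (hDm i)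
  have hDY : ∀ i, (eD i : V) ∉ Y := fun i => hdisj (hDX i)
  have hyX : y ∉ X := fun h => hdisj h hy
  intro a b
  rw [starDeletedGraph_adj hXY]
  rcases a with (a | a) | (a | a) <;> rcases b with (b | b) | (b | b) <;>
    simp [f, extremalGraph, bipartiteJoin, quasiComplement, hDm, hYm, hXm, hY', hX', hDX, hDY, hyX,
      hy, Subsingleton.elim _ (0 : Fin 1)]

open Classical Finset in
/-- A graph whose spectral radius is at least that of the extremal graph is a copy of it as soon as
the neighbourhood of some vertex has at most `k - 1` elements. -/
theorem eq_starDeletedGraph (hXY : IsCompl X Y) (hX : #X = n) (hY : #Y = n)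
    (hk : 2 ≤ k) (hkn : k ≤ n) (hy : y ∈ Y) (hD : D ⊆ X) (hDk : #D = k - 1) {G : SimpleGraph V}
    (hG : G.IsBipartiteWith (X : Set V) (Y : Set V))
    (hρ : graphSpectralRadius (extremalGraph n k) ≤ graphSpectralRadius G)
    (hyD : G.neighborFinset y ⊆ D) : G = starDeletedGraph X Y y D := by
  obtain ⟨e⟩ := nonempty_iso_extremalGraph hXY hX hY (by omega) hkn hy hD hDk
  refine eq_of_le_of_realSpectralRadius_le (le_starDeletedGraph hXY hG hyD)
    (starDeletedGraph_connected hXY hD (card_pos.1 (by omega))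
      (exists_mem_ne (by omega) y)) ?_
  rwa [realSpectralRadius_le_iff, graphSpectralRadius_eq_of_iso e]

open Classical Finset in
theorem le_degree_of_graphSpectralRadius_le (hXY : IsCompl X Y) (hX : #X = n) (hY : #Y = n)
    (hk : 2 ≤ k) (hkn : k ≤ n) (hy : y ∈ Y) {G : SimpleGraph V}
    (hG : G.IsBipartiteWith (X : Set V) (Y : Set V))
    (hρ : graphSpectralRadius (extremalGraph n k) ≤ graphSpectralRadius G) :
    k - 1 ≤ #(G.neighborFinset y) := by
  by_contra! h
  obtain ⟨D, hyD, hD, hDk⟩ := exists_subsuperset_card_eq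
    (SimpleGraph.isBipartiteWith_neighborFinset_subset hG.symm hy) h.le (by omega)
  have h1 := eq_starDeletedGraph hXY hX hY hk hkn hy hD hDk hG hρ hyD
  have h2 : G.neighborFinset y = D := by
    rw [← if_pos (rfl : y = y) (α := Finset V) (t := D) (e := X),
      ← neighborFinset_starDeletedGraph hXY hD hy]
    congr!
  rw [h2] at h
  omega

open Classical Finset in
/-- Outside the exceptional case no vertex has the same `k - 1` neighbours in all graphs. -/
theorem exists_le_card_neighborFinset_union (hXY : IsCompl X Y) (hX : #X = n) (hY : #Y = n)
    (hk : 2 ≤ k) (hkn : k ≤ n) (hy : y ∈ Y) {ι : Type*} {G : ι → SimpleGraph V}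
    (hG : ∀ i, (G i).IsBipartiteWith (X : Set V) (Y : Set V))
    (hρ : ∀ i, graphSpectralRadius (extremalGraph n k) ≤ graphSpectralRadius (G i))
    (hne : ¬ ((∀ i j, G i = G j) ∧ ∀ i, Nonempty (G i ≃g extremalGraph n k))) :
    ∃ i j, k ≤ #((G i).neighborFinset y ∪ (G j).neighborFinset y) := by
  by_contra! h
  have hdeg := fun i => le_degree_of_graphSpectralRadius_le hXY hX hY hk hkn hy (hG i) (hρ i)
  have hN : ∀ i j, (G j).neighborFinset y ⊆ (G i).neighborFinset y := fun i j => by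
    rw [← union_eq_left]
    exact (eq_of_subset_of_card_le subset_union_left (by have := h i j; have := hdeg i; omega)).symm
  have hD : ∀ i, #((G i).neighborFinset y) = k - 1 := fun i => by
    have := h i i
    rw [union_self] at this
    have := hdeg i
    omega
  have hX' := fun i => SimpleGraph.isBipartiteWith_neighborFinset_subset (hG i).symm hy
  have hstar : ∀ i j, G j = starDeletedGraph X Y y ((G i).neighborFinset y) := fun i j =>
    eq_starDeletedGraph hXY hX hY hk hkn hy (hX' i) (hD i) (hG j) (hρ j) (hN i j)
  refine hne ⟨fun i j => (hstar i i).trans (hstar i j).symm, fun i => ?_⟩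
  have := nonempty_iso_extremalGraph hXY hX hY (by omega) hkn hy (hX' i) (hD i)
  rwa [← hstar i i] at this

open Classical Finset in
theorem lt_sum_degree_of_graphSpectralRadius_le (hXY : IsCompl X Y) (hX : #X = n) (hY : #Y = n)
    (hk : 2 ≤ k) (hkn : k ≤ n) {G : SimpleGraph V}
    (hG : G.IsBipartiteWith (X : Set V) (Y : Set V))
    (hρ : graphSpectralRadius (extremalGraph n k) ≤ graphSpectralRadius G) :
    n * (n - 1) < ∑ x ∈ X, G.degree x := by
  obtain ⟨y, hy⟩ : Y.Nonempty := card_pos.1 (by omega)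
  obtain ⟨D, hD, hDk⟩ := exists_subset_card_eq (s := X) (n := k - 1) (by omega)
  obtain ⟨e⟩ := nonempty_iso_extremalGraph hXY hX hY (by omega) hkn hy hD hDk
  have h1 := lt_realSpectralRadius_starDeletedGraph_sq hXY hX hY (by omega) hy hD
    (card_pos.1 (by omega))
  have h2 : realSpectralRadius (starDeletedGraph X Y y D) ≤ realSpectralRadius G := by
    rwa [realSpectralRadius_le_iff, graphSpectralRadius_eq_of_iso e]
  have h3 := pow_le_pow_left₀ (realSpectralRadius_nonneg _) h2 2
  have h4 := (h1.trans_le h3).trans_le (realSpectralRadius_sq_le hXY hG)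
  rw [← Nat.cast_one, ← Nat.cast_sub (by omega)] at h4
  exact_mod_cast h4

end

/-! ### Rainbow factors -/

/-- The graph with the edges `s(x, y)` for `(x, y) ∈ F`. -/
def graphOfPairs {V : Type*} {X Y : Finset V} (F : Finset (X × Y)) : SimpleGraph V :=
  SimpleGraph.fromRel fun u v => ∃ e ∈ F, (e.1 : V) = u ∧ (e.2 : V) = v

section

variable {V : Type*} {X Y : Finset V}

theorem graphOfPairs_adj [DecidableEq V] (hXY : Disjoint X Y) (F : Finset (X × Y)) (u v : V) :
    (graphOfPairs F).Adj u v ↔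
      (∃ e ∈ F, (e.1 : V) = u ∧ (e.2 : V) = v) ∨ ∃ e ∈ F, (e.1 : V) = v ∧ (e.2 : V) = u := by
  rw [graphOfPairs, SimpleGraph.fromRel_adj]
  refine ⟨fun h => h.2, fun h => ⟨?_, h⟩⟩
  rintro rfl
  have := Finset.disjoint_left.1 hXY
  rcases h with ⟨e, -, h1, h2⟩ | ⟨e, -, h1, h2⟩ <;>
    exact this (h1 ▸ e.1.2) (h2 ▸ e.2.2)

open Classical Finset in
theorem graphOfPairs_isRegularOfDegree [Fintype V] (hXY : IsCompl X Y) {F : Finset (X × Y)} {k : ℕ}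
    (hx : ∀ x, #{e ∈ F | e.1 = x} = k) (hy : ∀ y, #{e ∈ F | e.2 = y} = k) :
    (graphOfPairs F).IsRegularOfDegree k := by
  have hdisj := disjoint_left.1 hXY.disjoint
  intro v
  rw [← SimpleGraph.card_neighborFinset_eq_degree]
  rcases mem_or_mem_of_isCompl hXY v with hv | hv
  · rw [← hx ⟨v, hv⟩, ← card_image_of_injOn (f := fun e : X × Y => (e.2 : V))]
    · congr 1
      ext u
      rw [SimpleGraph.mem_neighborFinset, graphOfPairs_adj hXY.disjoint]
      simp only [mem_image, mem_filter]
      constructor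
      · rintro (⟨e, he, h1, h2⟩ | ⟨e, he, h1, h2⟩)
        · exact ⟨e, ⟨he, Subtype.ext h1⟩, h2⟩
        · exact absurd (h2 ▸ e.2.2) (hdisj hv)
      · rintro ⟨e, ⟨he, h1⟩, h2⟩
        exact Or.inl ⟨e, he, congrArg Subtype.val h1, h2⟩
    · intro e he e' he' h
      exact Prod.ext ((mem_filter.1 he).2.trans (mem_filter.1 he').2.symm) (Subtype.ext h)
  · rw [← hy ⟨v, hv⟩, ← card_image_of_injOn (f := fun e : X × Y => (e.1 : V))]
    · congr 1
      ext u
      rw [SimpleGraph.mem_neighborFinset, graphOfPairs_adj hXY.disjoint]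
      simp only [mem_image, mem_filter]
      constructor
      · rintro (⟨e, he, h1, h2⟩ | ⟨e, he, h1, h2⟩)
        · exact absurd hv (hdisj (h1 ▸ e.1.2))
        · exact ⟨e, ⟨he, Subtype.ext h2⟩, h1⟩
      · rintro ⟨e, ⟨he, h1⟩, h2⟩
        exact Or.inr ⟨e, he, h2, congrArg Subtype.val h1⟩
    · intro e he e' he' h
      exact Prod.ext (Subtype.ext h) ((mem_filter.1 he).2.trans (mem_filter.1 he').2.symm)

theorem hasRainbowFactor_of_pairs [Fintype V] [DecidableEq V] (hXY : IsCompl X Y) {ι : Type*}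
    {G : ι → SimpleGraph V} {F : Finset (X × Y)} {k : ℕ}
    (hx : ∀ x, (F.filter fun e => e.1 = x).card = k)
    (hy : ∀ y, (F.filter fun e => e.2 = y).card = k) (φ : F ≃ ι)
    (hφ : ∀ e, (G (φ e)).Adj e.1.1 e.1.2) : HasRainbowFactor G k := by
  have hdisj := Finset.disjoint_left.1 hXY.disjoint
  let f : F → (graphOfPairs F).edgeSet := fun e =>
    ⟨s(e.1.1, e.1.2), (graphOfPairs_adj hXY.disjoint F _ _).2 (Or.inl ⟨e, e.2, rfl, rfl⟩)⟩
  have hf : f.Bijective := by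
    constructor
    · intro e e' h
      have h1 : s((e.1.1 : V), (e.1.2 : V)) = s((e'.1.1 : V), (e'.1.2 : V)) :=
        congrArg Subtype.val h
      rcases Sym2.eq_iff.1 h1 with ⟨h2, h3⟩ | ⟨h2, h3⟩
      · exact Subtype.ext (Prod.ext (Subtype.ext h2) (Subtype.ext h3))
      · exact absurd (h2 ▸ e'.1.2.2) (hdisj e.1.1.2)
    · rintro ⟨e, he⟩
      induction e with
      | _ u v =>
        rcases (graphOfPairs_adj hXY.disjoint F u v).1 he with ⟨e, h1, rfl, rfl⟩ | ⟨e, h1, rfl, rfl⟩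
        · exact ⟨⟨e, h1⟩, rfl⟩
        · exact ⟨⟨e, h1⟩, Subtype.ext Sym2.eq_swap⟩
  refine ⟨graphOfPairs F,
    by convert! graphOfPairs_isRegularOfDegree hXY (F := F) (by convert hx) (by convert hy),
    (Equiv.ofBijective f hf).symm.trans φ, fun e => ?_⟩
  obtain ⟨e, rfl⟩ := (Equiv.ofBijective f hf).surjective e
  simpa [f] using hφ e

open Classical Finset in
theorem hasRainbowFactor_of_graphSpectralRadius_le [Fintype V] {n k : ℕ} (hk : 2 ≤ k)
    (hn : 2 * k ≤ n) (hXY : IsCompl X Y) (hX : #X = n) (hY : #Y = n) {ι : Type*} [Fintype ι]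
    (hι : Fintype.card ι = k * n) (G : ι → SimpleGraph V)
    (hG : ∀ i, (G i).IsBipartiteWith (X : Set V) (Y : Set V))
    (hρ : ∀ i, graphSpectralRadius (extremalGraph n k) ≤ graphSpectralRadius (G i))
    (hne : ¬ ((∀ i j, G i = G j) ∧ ∀ i, Nonempty (G i ≃g extremalGraph n k))) :
    HasRainbowFactor G k := by
  have hkn : k ≤ n := by omega
  -- neighbourhoods, in the subtype of the opposite side
  have hNY : ∀ {X Y : Finset V} (y : Y) (i j : ι),
      (∀ i, (G i).IsBipartiteWith (X : Set V) (Y : Set V)) →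
      #{x : X | (G i).Adj x y ∨ (G j).Adj x y} =
        #((G i).neighborFinset y ∪ (G j).neighborFinset y) := by
    intro X Y y i j hG
    rw [← card_map (Function.Embedding.subtype _)]
    congr 1
    ext u
    simp only [mem_map, mem_filter, mem_univ, true_and, Function.Embedding.coe_subtype, mem_union,
      SimpleGraph.mem_neighborFinset]
    constructor
    · rintro ⟨x, h, rfl⟩
      exact h.imp SimpleGraph.Adj.symm SimpleGraph.Adj.symm
    · intro h
      refine ⟨⟨u, ?_⟩, h.imp SimpleGraph.Adj.symm SimpleGraph.Adj.symm, rfl⟩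
      rcases h with h | h
      · exact (hG i).symm.mem_of_mem_adj y.2 h
      · exact (hG j).symm.mem_of_mem_adj y.2 h
  have hGs := fun i => (hG i).symm
  obtain ⟨F, ⟨hFx, hFy⟩, φ, hφ⟩ := exists_rainbow_factor (α := X) (β := Y) hk hn (by simpa using hX)
    (by simpa using hY) hι (fun i => {e : X × Y | ¬ (G i).Adj e.1 e.2}) (fun i => by
      have h1 := lt_sum_degree_of_graphSpectralRadius_le hXY hX hY hk hkn (hG i) (hρ i)
      have h2 : #{e : X × Y | (G i).Adj e.1 e.2} = ∑ x ∈ X, (G i).degree x := by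
        rw [card_eq_sum_card_fiberwise (f := Prod.fst) (t := univ) (by simp),
          ← sum_coe_sort X]
        refine sum_congr rfl fun x _ => ?_
        have h3 := hNY x i i hGs
        rw [union_self, SimpleGraph.card_neighborFinset_eq_degree] at h3
        rw [← h3, ← card_map ⟨fun y : Y => (x, y), fun a b h => (Prod.ext_iff.1 h).2⟩]
        congr 1
        ext ⟨a, b⟩
        simp only [mem_filter, mem_univ, true_and, or_self, mem_map]
        constructor
        · rintro ⟨h, rfl⟩
          exact ⟨b, h.symm, rfl⟩
        · rintro ⟨b', h, h'⟩
          obtain ⟨rfl, rfl⟩ := Prod.ext_iff.1 h'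
          exact ⟨h.symm, rfl⟩
      have h4 := card_filter_add_card_filter_not (s := (univ : Finset (X × Y)))
        (fun e => (G i).Adj e.1 e.2)
      rw [h2, card_univ, Fintype.card_prod, Fintype.card_coe, Fintype.card_coe, hX, hY] at h4
      have h5 : n * (n - 1) + n = n * n := by
        rw [← Nat.mul_succ]; congr 1; omega
      omega)
    (fun x i => by
      have := le_degree_of_graphSpectralRadius_le hXY.symm hY hX hk hkn x.2 (hGs i) (hρ i)
      rw [← union_self ((G i).neighborFinset x), ← hNY x i i hGs] at this
      simpa [SimpleGraph.adj_comm] using this)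
    (fun y i => by
      have := le_degree_of_graphSpectralRadius_le hXY hX hY hk hkn y.2 (hG i) (hρ i)
      rw [← union_self ((G i).neighborFinset y), ← hNY y i i hG] at this
      simpa using this)
    (fun x => by
      obtain ⟨i, j, h⟩ := exists_le_card_neighborFinset_union hXY.symm hY hX hk hkn x.2 hGs hρ hne
      rw [← hNY x i j hGs] at h
      exact ⟨i, j, by simpa [SimpleGraph.adj_comm] using h⟩)
    (fun y => by
      obtain ⟨i, j, h⟩ := exists_le_card_neighborFinset_union hXY hX hY hk hkn y.2 hG hρ hne
      rw [← hNY y i j hG] at h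
      exact ⟨i, j, by simpa using h⟩)
  exact hasRainbowFactor_of_pairs hXY (fun x => by convert hFx x) (fun y => by convert hFy y) φ
    fun e => by simpa using hφ e

open Finset in
/-- In the extremal graph one vertex has only `k - 1` neighbours. -/
theorem not_hasRainbowFactor_of_iso [Fintype V] {n k : ℕ} (hk : 1 ≤ k) {ι : Type*}
    {G : ι → SimpleGraph V} {H : SimpleGraph V} (hG : ∀ i, G i = H)
    (e : H ≃g extremalGraph n k) : ¬ HasRainbowFactor G k := by
  classical
  rintro ⟨F, hF, φ, hφ⟩
  set v := e.symm (Sum.inr (Sum.inr 0)) with hv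
  have hFH : F ≤ H := fun a b hab => by
    have := hφ ⟨s(a, b), hab⟩
    rwa [hG] at this
  have h1 : F.neighborFinset v ⊆ univ.image fun i : Fin (k - 1) => e.symm (Sum.inl (Sum.inl i)) := by
    intro u hu
    have h2 : (extremalGraph n k).Adj (e v) (e u) :=
      e.map_adj_iff.2 (hFH (by simpa using hu))
    rw [hv, e.apply_symm_apply] at h2
    rw [mem_image]
    rcases heu : e u with (i | i) | (i | i)
    · exact ⟨i, mem_univ i, by rw [← heu, e.symm_apply_apply]⟩
    all_goals
      rw [heu] at h2
      simp [extremalGraph, bipartiteJoin, quasiComplement] at h2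
  have h3 := (card_le_card h1).trans card_image_le
  have h4 := hF v
  rw [← SimpleGraph.card_neighborFinset_eq_degree] at h4
  rw [card_univ, Fintype.card_fin] at h3
  have h5 : #(F.neighborFinset v) = k := by convert! h4
  omega

end

theorem theorem1p2 (n k : ℕ) (hk : 2 ≤ k) (hn : 2 * k ≤ n)
    (X Y : Finset (Fin (2 * n))) (hXY : IsCompl X Y) (hcard : X.card = Y.card) :
    (∀ G : Fin (k * n) → SimpleGraph (Fin (2 * n)),
      (∀ i, (G i).IsBipartiteWith (X : Set (Fin (2 * n))) (Y : Set (Fin (2 * n)))) →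
      (∀ i, graphSpectralRadius (extremalGraph n k) ≤ graphSpectralRadius (G i)) →
      (¬ HasRainbowFactor G k ↔
        (∀ i j, G i = G j) ∧ ∀ i, Nonempty (G i ≃g extremalGraph n k))) ∧
    (∃ H : SimpleGraph (Fin (2 * n)),
      H.IsBipartiteWith (X : Set (Fin (2 * n))) (Y : Set (Fin (2 * n))) ∧
      Nonempty (H ≃g extremalGraph n k) ∧
      graphSpectralRadius H = graphSpectralRadius (extremalGraph n k) ∧
      ¬ HasRainbowFactor (fun _ : Fin (k * n) => H) k) := by
  have hsum : X.card + Y.card = 2 * n := by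
    rw [card_add_card_of_isCompl hXY, Fintype.card_fin]
  have hX : X.card = n := by omega
  have hY : Y.card = n := by omega
  refine ⟨fun G hG hρ => ⟨fun h => ?_, fun h => ?_⟩, ?_⟩
  · by_contra hne
    exact h (hasRainbowFactor_of_graphSpectralRadius_le hk hn hXY hX hY (by simp) G hG hρ hne)
  · have hpos : 0 < k * n := Nat.mul_pos (by omega) (by omega)
    obtain ⟨e⟩ := h.2 ⟨0, hpos⟩
    exact not_hasRainbowFactor_of_iso (by omega) (fun i => h.1 i ⟨0, hpos⟩) e
  · obtain ⟨y, hy⟩ : Y.Nonempty := Finset.card_pos.1 (by omega)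
    obtain ⟨D, hD, hDk⟩ := Finset.exists_subset_card_eq (s := X) (n := k - 1) (by omega)
    obtain ⟨e⟩ := nonempty_iso_extremalGraph hXY hX hY (by omega) (by omega) hy hD hDk
    exact ⟨starDeletedGraph X Y y D, starDeletedGraph_isBipartiteWith hXY y D, ⟨e⟩,
      graphSpectralRadius_eq_of_iso e, not_hasRainbowFactor_of_iso (by omega) (fun _ => rfl) e⟩
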